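/- Let $D\ge 4$ and let $M$ be a smooth $D$-dimensional manifold with a smooth Lorentzian metric $g$ (signature $(-,+,\dots,+)$) and Levi-Civita connection $\nabla$ (denoted by a semicolon). Let $\mathcal A$ be a smooth one-form and $\phi$ a smooth function on $M$, let $\alpha,\beta$ be nonzero real constants, and put $\mathcal F_{ab}:=\mathcal A_{b;a}-\mathcal A_{a;b}$. (These are the fields of a Kaluza–Klein reduction $\hat g=e^{2\alpha\phi}g+e^{2\beta\phi}(dz+\mathcal A)^2$.) On an open set $U\subseteq M$ let $\ell=e_{(0)}$, $n=e_{(1)}$, $e_{(i)}$ ($i=2,\dots,D-1$) be a smooth null frame, i.e. a smooth frame in which the inverse metric is $$g^{ab}=\ell^a n^b+n^a\ell^b+\sum_{i=2}^{D-1}e_{(i)}^a e_{(i)}^b .$$ Let $\kappa^a:=\ell^a{}_{;b}\,\ell^b$ be the non-geodeticity of $\ell$, and let bracketed indices denote frame components. Assume that on $U$ $$\mathcal F_{(i)(j)}=0,\qquad \mathcal F_{(0)(1)}=0,\qquad \mathcal F_{(0)(i)}=0\qquad(i,j=2,\dots,D-1),$$ and that the reduced Maxwell equation $$\Big(e^{((D-4)\alpha+3\beta)\phi}\,g^{bc}\mathcal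 F_{ab}\Big)_{;c}=0$$ holds on $U$. Then at every point of $U$ either $\mathcal F$ vanishes or $\ell$ is weakly geodetic (that is, $\nabla_\ell\ell$ is proportional to $\ell$, the equation of a geodesic with arbitrary parametrization); moreover, $$\mathcal F_{(a)(b)}\,\kappa^{(i)}=0\quad\text{on }U\text{ for all }a,b\in\{0,\dots,D-1\},\ i\in\{2,\dots,D-1\}.$$ -/

import Mathlib

open Bundle Module
open scoped Manifold ContDiff

noncomputable section LorentzGeometry

variable {E : Type*} [NormedAddCommGroup E] [NormedSpace ℝ E]
  {H : Type*} [TopologicalSpace H] {I : ModelWithCorners ℝ E H}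
  {M : Type*} [TopologicalSpace M] [ChartedSpace H M] [IsManifold I ∞ M]

variable (I M) in
/-- A smooth Lorentzian metric on `M`, with signature `(-, +, …, +)`: at each point there is a
timelike vector on whose orthogonal complement the metric is positive definite. -/
structure LorentzMetric where
  /-- The scalar product on each tangent space. -/
  val (x : M) : TangentSpace I x →L[ℝ] TangentSpace I x →L[ℝ] ℝ
  symm (x : M) (v w : TangentSpace I x) : val x v w = val x w v
  lorentzian (x : M) : ∃ u : TangentSpace I x, val x u u < 0 ∧
    ∀ v : TangentSpace I x, val x u v = 0 → v ≠ 0 → 0 < val x v v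
  contMDiff : ContMDiff I (I.prod 𝓘(ℝ, E →L[ℝ] E →L[ℝ] ℝ)) ∞
    (fun x ↦ TotalSpace.mk' (E →L[ℝ] E →L[ℝ] ℝ) x (val x))

variable (I M) in
/-- A smooth one-form on `M`. -/
structure SmoothOneForm where
  /-- The covector at each point. -/
  val (x : M) : TangentSpace I x →L[ℝ] ℝ
  contMDiff : ContMDiff I (I.prod 𝓘(ℝ, E →L[ℝ] ℝ)) ∞
    (fun x ↦ TotalSpace.mk' (E →L[ℝ] ℝ) x (val x))

/-! ### Differentiability of contractions -/

theorem LorentzMetric.mdifferentiableAt (g : LorentzMetric I M)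
    {X Y : Π x : M, TangentSpace I x} {x : M} (hX : MDiffAt (T% X) x) (hY : MDiffAt (T% Y) x) :
    MDiffAt (fun y ↦ g.val y (X y) (Y y)) x := by
  have h : MDifferentiableAt I (I.prod 𝓘(ℝ, ℝ))
      (fun m ↦ TotalSpace.mk' ℝ (E := Bundle.Trivial M ℝ) m (g.val m (X m) (Y m))) x := by
    apply MDifferentiableAt.clm_bundle_apply₂ (F₁ := E) (F₂ := E)
    · exact (g.contMDiff x).mdifferentiableAt (by simp)
    · exact hX
    · exact hY
  simp only [mdifferentiableAt_totalSpace] at h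
  exact h.2

theorem SmoothOneForm.mdifferentiableAt (A : SmoothOneForm I M)
    {X : Π x : M, TangentSpace I x} {x : M} (hX : MDiffAt (T% X) x) :
    MDiffAt (fun y ↦ A.val y (X y)) x := by
  have h : MDifferentiableAt I (I.prod 𝓘(ℝ, ℝ))
      (fun m ↦ TotalSpace.mk' ℝ (E := Bundle.Trivial M ℝ) m (A.val m (X m))) x := by
    apply MDifferentiableAt.clm_bundle_apply (F₁ := E)
    · exact (A.contMDiff x).mdifferentiableAt (by simp)
    · exact hX
  simp only [mdifferentiableAt_totalSpace] at h
  exact h.2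

namespace LorentzMetric

/-! ### Nondegeneracy -/

theorem eq_zero_of_val_eq_zero (g : LorentzMetric I M) (x : M) {v : TangentSpace I x}
    (h : ∀ w, g.val x v w = 0) : v = 0 := by
  obtain ⟨u, -, hpos⟩ := g.lorentzian x
  by_contra hv
  have := hpos v (by rw [g.symm]; exact h u) hv
  rw [h v] at this
  exact lt_irrefl _ this

theorem nondegenerate (g : LorentzMetric I M) (x : M) :
    (g.val x).toBilinForm.Nondegenerate := by
  refine ⟨fun v h ↦ g.eq_zero_of_val_eq_zero x h, fun v h ↦ g.eq_zero_of_val_eq_zero x ?_⟩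
  intro w
  rw [g.symm]
  exact h w

theorem ext_val (g : LorentzMetric I M) (x : M) {v v' : TangentSpace I x}
    (h : ∀ w, g.val x v w = g.val x v' w) : v = v' := by
  rw [← sub_eq_zero]
  exact g.eq_zero_of_val_eq_zero x fun w ↦ by simp [h w]

/-! ### Index raising -/

section Raising

variable [FiniteDimensional ℝ E]

instance (x : M) : FiniteDimensional ℝ (TangentSpace I x) :=
  inferInstanceAs (FiniteDimensional ℝ E)

/-- Raising an index: the vector `v` with `g(v, w) = ξ(w)` for all `w`. -/
def sharp (g : LorentzMetric I M) (x : M) : Dual ℝ (TangentSpace I x) →ₗ[ℝ] TangentSpace I x :=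
  ((g.val x).toBilinForm.toDual (g.nondegenerate x)).symm

theorem val_sharp (g : LorentzMetric I M) (x : M) (ξ : Dual ℝ (TangentSpace I x))
    (w : TangentSpace I x) : g.val x (g.sharp x ξ) w = ξ w :=
  LinearMap.BilinForm.apply_toDual_symm_apply (B := (g.val x).toBilinForm)
    (hB := g.nondegenerate x) ..

end Raising

/-! ### The Koszul formula -/

/-- The right-hand side of the Koszul formula for `2 g(∇_X Y, Z)`. -/
def koszul (g : LorentzMetric I M) (X Y Z : Π x : M, TangentSpace I x) (x : M) : ℝ :=
  d% (fun y ↦ g.val y (Y y) (Z y)) x (X x) + d% (fun y ↦ g.val y (Z y) (X y)) x (Y x)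
    - d% (fun y ↦ g.val y (X y) (Y y)) x (Z x)
    + g.val x (VectorField.mlieBracket I X Y x) (Z x)
    - g.val x (VectorField.mlieBracket I Y Z x) (X x)
    + g.val x (VectorField.mlieBracket I Z X x) (Y x)

variable [CompleteSpace E]

theorem tensorialAt_koszul₁ (g : LorentzMetric I M) {Y Z : Π x : M, TangentSpace I x} {x : M}
    (hY : MDiffAt (T% Y) x) (hZ : MDiffAt (T% Z) x) :
    TensorialAt I E (fun X ↦ g.koszul X Y Z x) x where
  smul {f X} hf hX := by
    have h1 := mvfderiv_mul hf (g.mdifferentiableAt hZ hX)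
    have h2 := mvfderiv_mul hf (g.mdifferentiableAt hX hY)
    have e1 : (fun y ↦ g.val y (Z y) ((f • X) y)) = f * fun y ↦ g.val y (Z y) (X y) := by
      ext y; simp
    have e2 : (fun y ↦ g.val y ((f • X) y) (Y y)) = f * fun y ↦ g.val y (X y) (Y y) := by
      ext y; simp
    simp only [koszul, e1, e2, h1, h2, VectorField.mlieBracket_smul_left hf hX,
      VectorField.mlieBracket_smul_right hf hX]
    simp [g.symm x (X x) (Z x), g.symm x (X x) (Y x)]
    ring
  add {X X'} hX hX' := by
    have h1 := mvfderiv_add (g.mdifferentiableAt hZ hX) (g.mdifferentiableAt hZ hX')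
    have h2 := mvfderiv_add (g.mdifferentiableAt hX hY) (g.mdifferentiableAt hX' hY)
    have e1 : (fun y ↦ g.val y (Z y) ((X + X') y))
        = (fun y ↦ g.val y (Z y) (X y)) + fun y ↦ g.val y (Z y) (X' y) := by
      ext y; simp
    have e2 : (fun y ↦ g.val y ((X + X') y) (Y y))
        = (fun y ↦ g.val y (X y) (Y y)) + fun y ↦ g.val y (X' y) (Y y) := by
      ext y; simp
    simp only [koszul, e1, e2, h1, h2, VectorField.mlieBracket_add_left hX hX',
      VectorField.mlieBracket_add_right hX hX']
    simp
    ring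

theorem tensorialAt_koszul₃ (g : LorentzMetric I M) {X Y : Π x : M, TangentSpace I x} {x : M}
    (hX : MDiffAt (T% X) x) (hY : MDiffAt (T% Y) x) :
    TensorialAt I E (fun Z ↦ g.koszul X Y Z x) x where
  smul {f Z} hf hZ := by
    have h1 := mvfderiv_mul hf (g.mdifferentiableAt hY hZ)
    have h2 := mvfderiv_mul hf (g.mdifferentiableAt hZ hX)
    have e1 : (fun y ↦ g.val y (Y y) ((f • Z) y)) = f * fun y ↦ g.val y (Y y) (Z y) := by
      ext y; simp
    have e2 : (fun y ↦ g.val y ((f • Z) y) (X y)) = f * fun y ↦ g.val y (Z y) (X y) := by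
      ext y; simp
    simp only [koszul, e1, e2, h1, h2, VectorField.mlieBracket_smul_left hf hZ,
      VectorField.mlieBracket_smul_right hf hZ]
    simp [g.symm x (Z x) (X x), g.symm x (Z x) (Y x)]
    ring
  add {Z Z'} hZ hZ' := by
    have h1 := mvfderiv_add (g.mdifferentiableAt hY hZ) (g.mdifferentiableAt hY hZ')
    have h2 := mvfderiv_add (g.mdifferentiableAt hZ hX) (g.mdifferentiableAt hZ' hX)
    have e1 : (fun y ↦ g.val y (Y y) ((Z + Z') y))
        = (fun y ↦ g.val y (Y y) (Z y)) + fun y ↦ g.val y (Y y) (Z' y) := by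
      ext y; simp
    have e2 : (fun y ↦ g.val y ((Z + Z') y) (X y))
        = (fun y ↦ g.val y (Z y) (X y)) + fun y ↦ g.val y (Z' y) (X y) := by
      ext y; simp
    simp only [koszul, e1, e2, h1, h2, VectorField.mlieBracket_add_left hZ hZ',
      VectorField.mlieBracket_add_right hZ hZ']
    simp
    ring

/-! ### The Levi-Civita connection -/

variable [FiniteDimensional ℝ E]

open scoped Classical in
/-- The covariant derivative `u ↦ ∇_u Y` at `x`: the vector with
`2 g(∇_u Y, w) = koszul(u, Y, w)` (and zero, by convention, if `Y` is not differentiable at `x`). -/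
def nabla (g : LorentzMetric I M) (Y : Π x : M, TangentSpace I x) (x : M) :
    TangentSpace I x →L[ℝ] TangentSpace I x :=
  haveI : T2Space (TangentSpace I x) := inferInstanceAs (T2Space E)
  if hY : MDiffAt (T% Y) x then
    LinearMap.toContinuousLinearMap ((1 / 2 : ℝ) • (g.sharp x ∘ₗ
      (TensorialAt.mkHom₂ (I := I) (F := E) (F' := E) (fun X Z ↦ g.koszul X Y Z x) x
        (fun _ hZ ↦ g.tensorialAt_koszul₁ hY hZ)
        (fun _ hX ↦ g.tensorialAt_koszul₃ hX hY)).toBilinForm))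
  else 0

theorem two_mul_val_nabla (g : LorentzMetric I M) {X Y Z : Π x : M, TangentSpace I x} {x : M}
    (hX : MDiffAt (T% X) x) (hY : MDiffAt (T% Y) x) (hZ : MDiffAt (T% Z) x) :
    2 * g.val x (g.nabla Y x (X x)) (Z x) = g.koszul X Y Z x := by
  have h := TensorialAt.mkHom₂_apply (I := I) (F := E) (F' := E)
    (Φ := fun X Z ↦ g.koszul X Y Z x)
    (fun _ hZ ↦ g.tensorialAt_koszul₁ hY hZ) (fun _ hX ↦ g.tensorialAt_koszul₃ hX hY) hX hZ
  simp only [nabla, dif_pos hY]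
  simp [val_sharp]
  exact h

theorem nabla_eq (g : LorentzMetric I M) {Y : Π x : M, TangentSpace I x} {x : M}
    (hY : MDiffAt (T% Y) x) {L : TangentSpace I x →L[ℝ] TangentSpace I x}
    (h : ∀ X Z : Π x : M, TangentSpace I x, MDiffAt (T% X) x → MDiffAt (T% Z) x →
      2 * g.val x (L (X x)) (Z x) = g.koszul X Y Z x) :
    g.nabla Y x = L := by
  ext u
  refine g.ext_val x fun w ↦ ?_
  have hu := FiberBundle.mdifferentiableAt_extend I E u
  have hw := FiberBundle.mdifferentiableAt_extend I E w
  have h1 := g.two_mul_val_nabla hu hY hw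
  rw [← h _ _ hu hw] at h1
  simpa using h1

/-- The Levi-Civita connection of a Lorentzian metric. -/
def leviCivita (g : LorentzMetric I M) :
    CovariantDerivative I E (TangentSpace I : M → Type _) where
  toFun := g.nabla
  isCovariantDerivativeOnUniv :=
    { add := by
        intro Y Y' x hY hY' _
        refine g.nabla_eq (mdifferentiableAt_add_section hY hY') fun X Z hX hZ ↦ ?_
        have h1 := mvfderiv_add (g.mdifferentiableAt hY hZ) (g.mdifferentiableAt hY' hZ)
        have h2 := mvfderiv_add (g.mdifferentiableAt hX hY) (g.mdifferentiableAt hX hY')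
        have e1 : (fun y ↦ g.val y ((Y + Y') y) (Z y))
            = (fun y ↦ g.val y (Y y) (Z y)) + fun y ↦ g.val y (Y' y) (Z y) := by
          ext y; simp
        have e2 : (fun y ↦ g.val y (X y) ((Y + Y') y))
            = (fun y ↦ g.val y (X y) (Y y)) + fun y ↦ g.val y (X y) (Y' y) := by
          ext y; simp
        have k := g.two_mul_val_nabla hX hY hZ
        have k' := g.two_mul_val_nabla hX hY' hZ
        simp only [koszul] at k k'
        simp only [koszul, e1, e2, h1, h2, VectorField.mlieBracket_add_left hY hY',
          VectorField.mlieBracket_add_right hY hY']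
        simp
        linear_combination k + k'
      leibniz := by
        intro Y f x hY hf _
        refine g.nabla_eq (hf.smul_section hY) fun X Z hX hZ ↦ ?_
        have h1 := mvfderiv_mul hf (g.mdifferentiableAt hY hZ)
        have h2 := mvfderiv_mul hf (g.mdifferentiableAt hX hY)
        have e1 : (fun y ↦ g.val y ((f • Y) y) (Z y)) = f * fun y ↦ g.val y (Y y) (Z y) := by
          ext y; simp
        have e2 : (fun y ↦ g.val y (X y) ((f • Y) y)) = f * fun y ↦ g.val y (X y) (Y y) := by
          ext y; simp
        have k := g.two_mul_val_nabla hX hY hZ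
        simp only [koszul] at k
        simp only [koszul, e1, e2, h1, h2, VectorField.mlieBracket_smul_left hf hY,
          VectorField.mlieBracket_smul_right hf hY]
        simp [g.symm x (X x) (Y x)]
        linear_combination f x * k }

theorem leviCivita_torsion (g : LorentzMetric I M) : g.leviCivita.torsion = 0 := by
  rw [CovariantDerivative.torsion_eq_zero_iff]
  intro X Y x hX hY
  refine g.ext_val x fun w ↦ ?_
  have hw := FiberBundle.mdifferentiableAt_extend I E w
  have k1 := g.two_mul_val_nabla hX hY hw
  have k2 := g.two_mul_val_nabla hY hX hw
  have s1 : (fun y ↦ g.val y (X y) (Y y)) = fun y ↦ g.val y (Y y) (X y) := by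
    ext y; exact g.symm y _ _
  have s2 (V : Π x : M, TangentSpace I x) :
      (fun y ↦ g.val y (FiberBundle.extend E w y) (V y))
        = fun y ↦ g.val y (V y) (FiberBundle.extend E w y) := by
    ext y; exact g.symm y _ _
  simp only [koszul, s1, s2, VectorField.mlieBracket_swap_apply (V := Y) (W := X),
    VectorField.mlieBracket_swap_apply (V := FiberBundle.extend E w)] at k1 k2
  simp at k1 k2 ⊢
  change g.val x (g.nabla Y x (X x)) w - g.val x (g.nabla X x (Y x)) w = _
  linarith

theorem leviCivita_metric (g : LorentzMetric I M) {X Y Z : Π x : M, TangentSpace I x} {x : M}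
    (hX : MDiffAt (T% X) x) (hY : MDiffAt (T% Y) x) (hZ : MDiffAt (T% Z) x) :
    d% (fun y ↦ g.val y (Y y) (Z y)) x (X x)
      = g.val x (g.leviCivita Y x (X x)) (Z x) + g.val x (Y x) (g.leviCivita Z x (X x)) := by
  have k1 := g.two_mul_val_nabla hX hY hZ
  have k2 := g.two_mul_val_nabla hX hZ hY
  have s (V W : Π x : M, TangentSpace I x) :
      (fun y ↦ g.val y (V y) (W y)) = fun y ↦ g.val y (W y) (V y) := by
    ext y; exact g.symm y _ _
  simp only [koszul, s Z Y, s Z X, s Y X, VectorField.mlieBracket_swap_apply (V := Z) (W := Y),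
    VectorField.mlieBracket_swap_apply (V := Z) (W := X),
    VectorField.mlieBracket_swap_apply (V := Y) (W := X)] at k1 k2
  simp at k1 k2
  rw [g.symm x (Y x)]
  change _ = g.val x (g.nabla Y x (X x)) (Z x) + g.val x (g.nabla Z x (X x)) (Y x)
  linarith

/-! ### The Maxwell tensor and the reduced Maxwell equation -/

theorem tensorialAt_nablaForm (g : LorentzMetric I M) (A : SmoothOneForm I M) (x : M) :
    TensorialAt I E (fun Y ↦ d% (fun y ↦ A.val y (Y y)) x - A.val x ∘L g.leviCivita Y x) x where
  smul {f Y} hf hY := by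
    have h1 := mvfderiv_mul hf (A.mdifferentiableAt hY)
    have e1 : (fun y ↦ A.val y ((f • Y) y)) = f * fun y ↦ A.val y (Y y) := by
      ext y; simp
    simp only [e1, h1, g.leviCivita.isCovariantDerivativeOnUniv.leibniz hY hf]
    ext u
    simp
    ring
  add {Y Y'} hY hY' := by
    have h1 := mvfderiv_add (A.mdifferentiableAt hY) (A.mdifferentiableAt hY')
    have e1 : (fun y ↦ A.val y ((Y + Y') y))
        = (fun y ↦ A.val y (Y y)) + fun y ↦ A.val y (Y' y) := by
      ext y; simp
    simp only [e1, h1, g.leviCivita.isCovariantDerivativeOnUniv.add hY hY']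
    ext u
    simp
    ring

/-- The covariant derivative of a one-form, `nablaForm x w u = (∇_u A)(w) = A_{b;a} w^b u^a`; for a
vector field `Y` through `w` it is `u(A(Y)) - A(∇_u Y)`. -/
def nablaForm (g : LorentzMetric I M) (A : SmoothOneForm I M) (x : M) :
    TangentSpace I x →L[ℝ] TangentSpace I x →L[ℝ] ℝ :=
  TensorialAt.mkHom (I := I) (F := E)
    (fun Y ↦ d% (fun y ↦ A.val y (Y y)) x - A.val x ∘L g.leviCivita Y x) x
    (g.tensorialAt_nablaForm A x)

/-- The Maxwell tensor `F_{ab} = A_{b;a} - A_{a;b}` of the potential `A`,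
with `maxwell x v w = F_{ab} v^a w^b`. -/
def maxwell (g : LorentzMetric I M) (A : SmoothOneForm I M) (x : M) :
    LinearMap.BilinForm ℝ (TangentSpace I x) :=
  (g.nablaForm A x).toBilinForm.flip - (g.nablaForm A x).toBilinForm

/-- The divergence `S_a^c_{;c} Y^a` of a `(1,1)`-tensor field `S_a^c`, regarded as the field of
endomorphisms `v^a ↦ S_a^c v^a`: the trace of `u ↦ (∇_u S)(Y) = ∇_u (S Y) - S (∇_u Y)`. -/
def divergence (g : LorentzMetric I M)
    (S : Π x : M, TangentSpace I x →ₗ[ℝ] TangentSpace I x)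
    (Y : Π x : M, TangentSpace I x) (x : M) : ℝ :=
  LinearMap.trace ℝ (TangentSpace I x)
    ((g.leviCivita (fun y ↦ S y (Y y)) x).toLinearMap - S x ∘ₗ (g.leviCivita Y x).toLinearMap)

/-- The `(1,1)`-tensor field `S_a^c = f g^{bc} F_{ab}`, for a function `f`. -/
def raisedMaxwell (g : LorentzMetric I M) (A : SmoothOneForm I M) (f : M → ℝ) (x : M) :
    TangentSpace I x →ₗ[ℝ] TangentSpace I x :=
  f x • (g.sharp x ∘ₗ g.maxwell A x)

/-- The reduced Maxwell equation `(e^{((D - 4) α + 3 β) φ} g^{bc} F_{ab})_{;c} = 0` on `U`, where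
`D` is the dimension of the manifold. -/
def ReducedMaxwellOn (g : LorentzMetric I M) (A : SmoothOneForm I M) (φ : M → ℝ) (α β : ℝ)
    (U : Set M) : Prop :=
  ∀ x ∈ U, ∀ Y : Π x : M, TangentSpace I x, CMDiffAt ∞ (T% Y) x →
    g.divergence (g.raisedMaxwell A
      fun y ↦ Real.exp ((((finrank ℝ E : ℝ) - 4) * α + 3 * β) * φ y)) Y x = 0

/-! ### Null frames and geodeticity -/

/-- A smooth null frame `ℓ = e 0`, `n = e 1`, `e_i` (`i = 2, …, D - 1`) on `U`: a smooth local frame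
in which the inverse metric is `ℓ ⊗ n + n ⊗ ℓ + ∑ i, e_i ⊗ e_i`. -/
structure IsNullFrameOn {d : ℕ} (g : LorentzMetric I M)
    (e : Fin (d + 2) → Π x : M, TangentSpace I x) (U : Set M) : Prop
    extends IsLocalFrameOn I E ∞ e U where
  inverse_metric : ∀ x ∈ U, ∀ ξ η : Dual ℝ (TangentSpace I x),
    ξ (g.sharp x η) = ξ (e 0 x) * η (e 1 x) + ξ (e 1 x) * η (e 0 x)
      + ∑ i : Fin d, ξ (e i.succ.succ x) * η (e i.succ.succ x)

/-- The non-geodeticity `κ^a = ℓ^a_{;b} ℓ^b` of a vector field. -/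
def kappa (g : LorentzMetric I M) (ℓ : Π x : M, TangentSpace I x) (x : M) : TangentSpace I x :=
  g.leviCivita ℓ x (ℓ x)

/-- `ℓ` is weakly geodetic at `x`: its acceleration `∇_ℓ ℓ` is proportional to `ℓ`, which is the
equation of a geodesic with arbitrary parametrization. -/
def IsWeaklyGeodeticAt (g : LorentzMetric I M) (ℓ : Π x : M, TangentSpace I x) (x : M) : Prop :=
  ∃ c : ℝ, g.kappa ℓ x = c • ℓ x

end LorentzMetric

end LorentzGeometry

section NullFrameMaxwell

variable {E : Type*} [NormedAddCommGroup E] [NormedSpace ℝ E]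
  {H : Type*} [TopologicalSpace H] {I : ModelWithCorners ℝ E H}
  {M : Type*} [TopologicalSpace M] [ChartedSpace H M] [IsManifold I ∞ M]

/-! ### Directional derivatives and Lie brackets -/

/-! Write ℓ = `e 0`, n = `e 1`, F for the Maxwell tensor, ω_i = F(n, e_i) and κ_i = g(κ, e_i). The
hypotheses say that ℓ is in the kernel of F and that the ω_i are the only components left, so F(v,
e_j) = g(v, ℓ) ω_j for every v.

Two relations between κ and ω follow. The Bianchi identity dF(ℓ, e_i, e_j) = 0 involves only
brackets here, since F vanishes on each pair of these fields; as g([ℓ, e_i], ℓ) = -κ_i, it reads κ_i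
ω_j = κ_j ω_i (`kappa_mul_maxwell_comm`). The Maxwell equation contracted with ℓ reduces to F(κ, n)
= 0, that is ∑ κ_i ω_i = 0 (`sum_kappa_mul_maxwell`).

So the transverse vectors κ and ω are both parallel and orthogonal in a Euclidean space: κ_j |ω|² =
ω_j ∑ κ_i ω_i = 0. Either ω = 0, and then F = 0, or every κ_i vanishes. In the second case g(κ, ℓ) =
0, which holds because ℓ is null, leaves κ only a component along ℓ. -/

theorem ContMDiffOn.mvfderiv_apply {f : M → ℝ} {X : Π x : M, TangentSpace I x} {U : Set M}
    (hU : IsOpen U) (hf : CMDiff[U] ∞ f) (hX : CMDiff[U] ∞ (T% X)) :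
    CMDiff[U] ∞ (fun y ↦ d% f y (X y)) := by
  have h1 := hf.contMDiffOn_tangentMapWithin (m := ∞) (by simp) hU.uniqueMDiffOn
  have h2 := h1.comp hX (fun y hy ↦ hy)
  have h3 := (contMDiff_snd_tangentBundle_modelSpace ℝ 𝓘(ℝ, ℝ) (n := ∞)).comp_contMDiffOn h2
  refine h3.congr fun y hy ↦ ?_
  simp only [mvfderiv, Function.comp, tangentMapWithin, mfderivWithin_of_isOpen hU hy]
  rfl

theorem SmoothOneForm.contMDiffOn_apply (A : SmoothOneForm I M) {X : Π x : M, TangentSpace I x}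
    {U : Set M} (hX : CMDiff[U] ∞ (T% X)) : CMDiff[U] ∞ (fun y ↦ A.val y (X y)) := by
  have h : ContMDiffOn I (I.prod 𝓘(ℝ, ℝ)) ∞
      (fun m ↦ TotalSpace.mk' ℝ (E := Bundle.Trivial M ℝ) m (A.val m (X m))) U :=
    ContMDiffOn.clm_bundle_apply (F₁ := E) A.contMDiff.contMDiffOn hX
  intro y hy
  have := h y hy
  simp only [contMDiffWithinAt_totalSpace] at this
  exact this.2

variable [CompleteSpace E]

theorem ContMDiffAt.mlieBracket {X Y : Π x : M, TangentSpace I x} {x : M}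
    (hX : CMDiffAt ∞ (T% X) x) (hY : CMDiffAt ∞ (T% Y) x) :
    CMDiffAt ∞ (T% (VectorField.mlieBracket I X Y)) x := by
  have : IsManifold I (minSmoothness ℝ 2) M := by
    simp only [minSmoothness_of_isRCLikeNormedField]
    infer_instance
  have : IsManifold I (((⊤ : ℕ∞) : ℕ∞ω) + 1) M := by simpa using ‹IsManifold I ∞ M›
  exact ContMDiffAt.mlieBracket_vectorField (n := ⊤) (m := ⊤) hX hY (by simp)

theorem mlieBracket_jacobi {X Y Z : Π x : M, TangentSpace I x} {x : M}
    (hX : CMDiffAt ∞ (T% X) x) (hY : CMDiffAt ∞ (T% Y) x) (hZ : CMDiffAt ∞ (T% Z) x) :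
    VectorField.mlieBracket I X (VectorField.mlieBracket I Y Z) x =
      VectorField.mlieBracket I (VectorField.mlieBracket I X Y) Z x
        + VectorField.mlieBracket I Y (VectorField.mlieBracket I X Z) x := by
  have : IsManifold I (minSmoothness ℝ 3) M := by
    simp only [minSmoothness_of_isRCLikeNormedField]
    exact IsManifold.of_le (n := ∞) ENat.LEInfty.out
  have h2 : minSmoothness ℝ 2 ≤ ∞ := by
    simp only [minSmoothness_of_isRCLikeNormedField]
    exact ENat.LEInfty.out
  exact VectorField.leibniz_identity_mlieBracket_apply (hX.of_le h2) (hY.of_le h2) (hZ.of_le h2)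

/-- Follows from the Jacobi identity for X, Y and f Z, expanded by the Leibniz rule: the mixed
first-order terms cancel, Jacobi for X, Y, Z removes the terms with f undifferentiated, and what
remains is a multiple of Z. The auxiliary field Z serves only to read off this coefficient, hence `Z
x ≠ 0`. -/
theorem mvfderiv_mlieBracket {f : M → ℝ} {X Y Z : Π x : M, TangentSpace I x} {U : Set M}
    (hU : IsOpen U) (hf : CMDiff[U] ∞ f) (hX : CMDiff[U] ∞ (T% X)) (hY : CMDiff[U] ∞ (T% Y))
    (hZ : CMDiff[U] ∞ (T% Z)) {x : M} (hx : x ∈ U) (hZx : Z x ≠ 0) :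
    d% f x (VectorField.mlieBracket I X Y x) =
      d% (fun y ↦ d% f y (Y y)) x (X x) - d% (fun y ↦ d% f y (X y)) x (Y x) := by
  have key : ∀ {V W : Π x : M, TangentSpace I x}, CMDiff[U] ∞ (T% V) → CMDiff[U] ∞ (T% W) →
      VectorField.mlieBracket I V (VectorField.mlieBracket I W (f • Z)) x =
        d% (fun y ↦ d% f y (W y)) x (V x) • Z x + d% f x (W x) • VectorField.mlieBracket I V Z x
        + d% f x (V x) • VectorField.mlieBracket I W Z x
        + f x • VectorField.mlieBracket I V (VectorField.mlieBracket I W Z) x := by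
    intro V W hV hW
    have hU' := hU.mem_nhds hx
    have e : VectorField.mlieBracket I W (f • Z) =ᶠ[nhds x]
        (fun y ↦ d% f y (W y)) • Z + f • VectorField.mlieBracket I W Z := by
      filter_upwards [hU'] with y hy
      exact VectorField.mlieBracket_smul_right
        ((hf.contMDiffAt (hU.mem_nhds hy)).mdifferentiableAt (by simp))
        ((hZ.contMDiffAt (hU.mem_nhds hy)).mdifferentiableAt (by simp))
    have hWf := ((ContMDiffOn.mvfderiv_apply hU hf hW).contMDiffAt hU').mdifferentiableAt
      (by simp)
    have hfx := (hf.contMDiffAt hU').mdifferentiableAt (by simp)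
    have hZ' := (hZ.contMDiffAt hU').mdifferentiableAt (by simp)
    have hWZ := (ContMDiffAt.mlieBracket (hW.contMDiffAt hU') (hZ.contMDiffAt hU')).mdifferentiableAt
      (by simp)
    rw [(Filter.EventuallyEq.refl _ V).mlieBracket_vectorField_eq e,
      VectorField.mlieBracket_add_right (hWf.smul_section hZ') (hfx.smul_section hWZ),
      VectorField.mlieBracket_smul_right hWf hZ', VectorField.mlieBracket_smul_right hfx hWZ]
    module
  have hU' := hU.mem_nhds hx
  have hX' := hX.contMDiffAt hU'
  have hY' := hY.contMDiffAt hU'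
  have hZ' := hZ.contMDiffAt hU'
  have j1 := mlieBracket_jacobi hX' hY' hZ'
  have j2 := mlieBracket_jacobi hX' hY' ((hf.contMDiffAt hU').smul_section hZ')
  rw [key hX hY, key hY hX, VectorField.mlieBracket_smul_right
    ((hf.contMDiffAt hU').mdifferentiableAt (by simp)) (hZ'.mdifferentiableAt (by simp)), j1] at j2
  have : (d% f x (VectorField.mlieBracket I X Y x) -
      (d% (fun y ↦ d% f y (Y y)) x (X x) - d% (fun y ↦ d% f y (X y)) x (Y x))) • Z x = 0 := by
    have := sub_eq_zero.2 j2.symm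
    rw [← this]
    module
  exact sub_eq_zero.1 ((smul_eq_zero.1 this).resolve_right hZx)

namespace LorentzMetric

variable [FiniteDimensional ℝ E]

/-! ### The Maxwell tensor as an exterior derivative -/

theorem maxwell_swap (g : LorentzMetric I M) (A : SmoothOneForm I M) (x : M)
    (v w : TangentSpace I x) : g.maxwell A x v w = -g.maxwell A x w v := by
  simp [maxwell]

theorem maxwell_self (g : LorentzMetric I M) (A : SmoothOneForm I M) (x : M)
    (v : TangentSpace I x) : g.maxwell A x v v = 0 := by
  simp [maxwell]

/-- The torsion-free property turns the two terms A(∇Y), A(∇X) into A of a Lie bracket, so F = dA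
and the metric drops out. -/
theorem maxwell_apply (g : LorentzMetric I M) (A : SmoothOneForm I M)
    {X Y : Π x : M, TangentSpace I x} {x : M}
    (hX : MDiffAt (T% X) x) (hY : MDiffAt (T% Y) x) :
    g.maxwell A x (X x) (Y x) = d% (fun y ↦ A.val y (Y y)) x (X x)
      - d% (fun y ↦ A.val y (X y)) x (Y x) - A.val x (VectorField.mlieBracket I X Y x) := by
  have hn : ∀ {V W : Π x : M, TangentSpace I x}, MDiffAt (T% W) x →
      g.nablaForm A x (W x) (V x)
        = d% (fun y ↦ A.val y (W y)) x (V x) - A.val x (g.leviCivita W x (V x)) := by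
    intro V W hW
    rw [nablaForm, TensorialAt.mkHom_apply _ hW]
    simp
  have ht := (CovariantDerivative.torsion_eq_zero_iff _).1 g.leviCivita_torsion hX hY
  have : g.maxwell A x (X x) (Y x)
      = g.nablaForm A x (Y x) (X x) - g.nablaForm A x (X x) (Y x) := by
    simp [maxwell]
  rw [this, hn hX, hn hY, ← ht, map_sub]
  ring

/-- The Bianchi identity `dF = 0`, for three vector fields on which `F` vanishes pairwise. -/
theorem maxwell_mlieBracket_cyclic (g : LorentzMetric I M) (A : SmoothOneForm I M)
    {X Y Z : Π x : M, TangentSpace I x} {U : Set M} (hU : IsOpen U)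
    (hX : CMDiff[U] ∞ (T% X)) (hY : CMDiff[U] ∞ (T% Y)) (hZ : CMDiff[U] ∞ (T% Z))
    (hXY : ∀ y ∈ U, g.maxwell A y (X y) (Y y) = 0) (hYZ : ∀ y ∈ U, g.maxwell A y (Y y) (Z y) = 0)
    (hZX : ∀ y ∈ U, g.maxwell A y (Z y) (X y) = 0) {x : M} (hx : x ∈ U) (hXx : X x ≠ 0) :
    g.maxwell A x (VectorField.mlieBracket I X Y x) (Z x)
      + g.maxwell A x (VectorField.mlieBracket I Y Z x) (X x)
      + g.maxwell A x (VectorField.mlieBracket I Z X x) (Y x) = 0 := by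
  -- With B = [P, Q], F(B, R) = B(A(R)) - R(A(B)) - A([B, R]). In the cyclic sum the second
  -- derivatives cancel in pairs and the double brackets cancel by Jacobi.
  have key : ∀ {P Q R : Π x : M, TangentSpace I x}, CMDiff[U] ∞ (T% P) → CMDiff[U] ∞ (T% Q) →
      CMDiff[U] ∞ (T% R) → (∀ y ∈ U, g.maxwell A y (P y) (Q y) = 0) →
      g.maxwell A x (VectorField.mlieBracket I P Q x) (R x) =
        d% (fun y ↦ d% (fun z ↦ A.val z (R z)) y (Q y)) x (P x)
        - d% (fun y ↦ d% (fun z ↦ A.val z (R z)) y (P y)) x (Q x)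
        - (d% (fun y ↦ d% (fun z ↦ A.val z (Q z)) y (P y)) x (R x)
          - d% (fun y ↦ d% (fun z ↦ A.val z (P z)) y (Q y)) x (R x))
        - A.val x (VectorField.mlieBracket I (VectorField.mlieBracket I P Q) R x) := by
    intro P Q R hP hQ hR hPQ
    have hU' := hU.mem_nhds hx
    have hB := ContMDiffAt.mlieBracket (hP.contMDiffAt hU') (hQ.contMDiffAt hU')
    have hAP := A.contMDiffOn_apply hP
    have hAQ := A.contMDiffOn_apply hQ
    have hAR := A.contMDiffOn_apply hR
    rw [g.maxwell_apply A (hB.mdifferentiableAt (by simp))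
      ((hR.contMDiffAt hU').mdifferentiableAt (by simp)),
      mvfderiv_mlieBracket hU hAR hP hQ hX hx hXx]
    -- A(B) is about to be differentiated along R, so F(P, Q) = 0 is needed on a neighbourhood, not
    -- just at x.
    have e : (fun y ↦ A.val y (VectorField.mlieBracket I P Q y)) =ᶠ[nhds x]
        (fun y ↦ d% (fun z ↦ A.val z (Q z)) y (P y))
          - (fun y ↦ d% (fun z ↦ A.val z (P z)) y (Q y)) := by
      filter_upwards [hU'] with y hy
      have h := g.maxwell_apply A
        ((hP.contMDiffAt (hU.mem_nhds hy)).mdifferentiableAt (by simp))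
        ((hQ.contMDiffAt (hU.mem_nhds hy)).mdifferentiableAt (by simp))
      rw [hPQ y hy] at h
      simp only [Pi.sub_apply]
      linarith
    have e' : d% (fun y ↦ A.val y (VectorField.mlieBracket I P Q y)) x
        = d% ((fun y ↦ d% (fun z ↦ A.val z (Q z)) y (P y))
          - (fun y ↦ d% (fun z ↦ A.val z (P z)) y (Q y))) x := by
      ext v
      simp only [mvfderiv, e.mfderiv_eq]
      rfl
    rw [e', mvfderiv_sub
      (((ContMDiffOn.mvfderiv_apply hU hAQ hP).contMDiffAt hU').mdifferentiableAt (by simp))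
      (((ContMDiffOn.mvfderiv_apply hU hAP hQ).contMDiffAt hU').mdifferentiableAt (by simp))]
    simp
  have hU' := hU.mem_nhds hx
  have j := congrArg (A.val x) (mlieBracket_jacobi (hX.contMDiffAt hU') (hY.contMDiffAt hU')
    (hZ.contMDiffAt hU'))
  rw [VectorField.mlieBracket_swap_apply (V := X) (W := VectorField.mlieBracket I Y Z),
    VectorField.mlieBracket_swap_apply (V := Y) (W := VectorField.mlieBracket I X Z),
    VectorField.mlieBracket_swap (V := X) (W := Z)] at j
  have s : VectorField.mlieBracket I (-VectorField.mlieBracket I Z X) Y x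
      = -VectorField.mlieBracket I (VectorField.mlieBracket I Z X) Y x := by
    have := VectorField.mlieBracket_const_smul_left (c := (-1 : ℝ)) (W := Y)
      ((ContMDiffAt.mlieBracket (hZ.contMDiffAt hU') (hX.contMDiffAt hU')).mdifferentiableAt (by simp))
    simpa using this
  rw [s] at j
  simp only [map_neg, map_add] at j
  rw [key hX hY hZ hXY, key hY hZ hX hYZ, key hZ hX hY hZX]
  linarith

end LorentzMetric
end NullFrameMaxwell

section NullFrameMaxwell

variable {E : Type*} [NormedAddCommGroup E] [NormedSpace ℝ E] [FiniteDimensional ℝ E]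
  {H : Type*} [TopologicalSpace H] {I : ModelWithCorners ℝ E H}
  {M : Type*} [TopologicalSpace M] [ChartedSpace H M] [IsManifold I ∞ M]

namespace LorentzMetric

namespace IsNullFrameOn

/-! ### Frame components -/

variable {d : ℕ} {g : LorentzMetric I M} {e : Fin (d + 2) → Π x : M, TangentSpace I x} {U : Set M}

theorem mdifferentiableAt (he : g.IsNullFrameOn e U) (hU : IsOpen U) {x : M} (hx : x ∈ U)
    (a : Fin (d + 2)) : MDiffAt (T% (e a)) x :=
  ((he.contMDiffOn a).contMDiffAt (hU.mem_nhds hx)).mdifferentiableAt (by simp)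

/-- Evaluate the inverse metric on the covectors g(w, ·) and g(v, ·). The null pair is dual to
itself with the order exchanged: the coefficient along ℓ is g(v, n), and conversely. -/
theorem expansion (he : g.IsNullFrameOn e U) {x : M} (hx : x ∈ U) (v : TangentSpace I x) :
    v = g.val x v (e 1 x) • e 0 x + g.val x v (e 0 x) • e 1 x
      + ∑ i : Fin d, g.val x v (e i.succ.succ x) • e i.succ.succ x := by
  refine g.ext_val x fun w ↦ ?_
  have h := he.inverse_metric x hx (g.val x w).toLinearMap (g.val x v).toLinearMap
  have hs : g.sharp x (g.val x v).toLinearMap = v :=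
    g.ext_val x fun u ↦ g.val_sharp x _ u
  rw [hs] at h
  simp only [ContinuousLinearMap.coe_coe] at h
  rw [g.symm x v w, h, g.symm x _ w]
  simp only [map_add, map_smul, map_sum, smul_eq_mul]
  congr 1
  · ring
  · exact Finset.sum_congr rfl fun i _ ↦ mul_comm _ _

theorem repr_eq (he : g.IsNullFrameOn e U) {x : M} (hx : x ∈ U) (v : TangentSpace I x) :
    ((he.toIsLocalFrameOn.toBasisAt hx).repr v : Fin (d + 2) → ℝ)
      = Fin.cons (g.val x v (e 1 x)) (Fin.cons (g.val x v (e 0 x))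
          fun i : Fin d ↦ g.val x v (e i.succ.succ x)) := by
  set b := he.toIsLocalFrameOn.toBasisAt hx with hb
  have h : v = ∑ a, (Fin.cons (g.val x v (e 1 x)) (Fin.cons (g.val x v (e 0 x))
      fun i : Fin d ↦ g.val x v (e i.succ.succ x)) : Fin (d + 2) → ℝ) a • b a := by
    rw [Fin.sum_univ_succ, Fin.sum_univ_succ]
    simp only [Fin.cons_zero, Fin.cons_succ, hb, IsLocalFrameOn.toBasisAt_coe, ← add_assoc]
    exact he.expansion hx v
  conv_lhs => rw [h]
  exact b.repr_sum_self _

theorem coeff_succ_succ (he : g.IsNullFrameOn e U) {x : M} (hx : x ∈ U) (v : TangentSpace I x)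
    (i : Fin d) :
    he.toIsLocalFrameOn.coeff i.succ.succ x v = g.val x v (e i.succ.succ x) := by
  simp [IsLocalFrameOn.coeff, hx, he.repr_eq hx v]

/-- These products are read off from the coordinates of ℓ in its own frame. -/
theorem val_frame (he : g.IsNullFrameOn e U) {x : M} (hx : x ∈ U) :
    g.val x (e 0 x) (e 0 x) = 0 ∧ ∀ i : Fin d, g.val x (e 0 x) (e i.succ.succ x) = 0 := by
  have h := he.repr_eq hx (e 0 x)
  rw [← he.toIsLocalFrameOn.toBasisAt_coe hx 0, Basis.repr_self] at h
  simp only [IsLocalFrameOn.toBasisAt_coe] at h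
  constructor
  · simpa using (congrFun h 1).symm
  · intro i
    simpa using (congrFun h i.succ.succ).symm

theorem trace_eq (he : g.IsNullFrameOn e U) {x : M} (hx : x ∈ U)
    (T : TangentSpace I x →ₗ[ℝ] TangentSpace I x) :
    LinearMap.trace ℝ _ T = g.val x (T (e 0 x)) (e 1 x) + g.val x (T (e 1 x)) (e 0 x)
      + ∑ i : Fin d, g.val x (T (e i.succ.succ x)) (e i.succ.succ x) := by
  rw [LinearMap.trace_eq_matrix_trace ℝ (he.toIsLocalFrameOn.toBasisAt hx)]
  simp only [Matrix.trace, Matrix.diag, LinearMap.toMatrix_apply, he.repr_eq hx,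
    IsLocalFrameOn.toBasisAt_coe]
  rw [Fin.sum_univ_succ, Fin.sum_univ_succ]
  simp [add_assoc]

/-- Metric compatibility applied to g(ℓ, ℓ), which vanishes near x. -/
theorem val_nabla_zero (he : g.IsNullFrameOn e U) (hU : IsOpen U) {x : M} (hx : x ∈ U)
    (v : TangentSpace I x) : g.val x (g.leviCivita (e 0) x v) (e 0 x) = 0 := by
  have h0 := he.mdifferentiableAt hU hx 0
  have h := g.leviCivita_metric (FiberBundle.mdifferentiableAt_extend I E v) h0 h0
  have hz : (fun y ↦ g.val y (e 0 y) (e 0 y)) =ᶠ[nhds x] fun _ ↦ 0 := by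
    filter_upwards [hU.mem_nhds hx] with y hy using (he.val_frame hy).1
  have hd : d% (fun y ↦ g.val y (e 0 y) (e 0 y)) x = 0 := by
    rw [← mvfderiv_const (I := I) (0 : ℝ) (x := x)]
    ext u
    simp only [mvfderiv, hz.mfderiv_eq]
    rfl
  rw [hd, g.symm x (e 0 x)] at h
  simp only [zero_apply, FiberBundle.extend_apply_self] at h
  linarith

/-- `g([ℓ, e_i], ℓ) = -κ_i`. -/
theorem val_mlieBracket_zero (he : g.IsNullFrameOn e U) (hU : IsOpen U) {x : M} (hx : x ∈ U)
    (i : Fin d) : g.val x (VectorField.mlieBracket I (e 0) (e i.succ.succ) x) (e 0 x)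
      = -g.val x (g.kappa (e 0) x) (e i.succ.succ x) := by
  have h0 := he.mdifferentiableAt hU hx 0
  have hi := he.mdifferentiableAt hU hx i.succ.succ
  have ht := (CovariantDerivative.torsion_eq_zero_iff _).1 g.leviCivita_torsion h0 hi
  have h := g.leviCivita_metric h0 h0 hi
  have hz : (fun y ↦ g.val y (e 0 y) (e i.succ.succ y)) =ᶠ[nhds x] fun _ ↦ 0 := by
    filter_upwards [hU.mem_nhds hx] with y hy using (he.val_frame hy).2 i
  have hd : d% (fun y ↦ g.val y (e 0 y) (e i.succ.succ y)) x = 0 := by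
    rw [← mvfderiv_const (I := I) (0 : ℝ) (x := x)]
    ext u
    simp only [mvfderiv, hz.mfderiv_eq]
    rfl
  rw [hd, g.symm x (e 0 x)] at h
  rw [← ht, map_sub, sub_apply, he.val_nabla_zero hU hx, kappa]
  simp only [zero_apply] at h
  linarith

/-! ### Maxwell tensors with only the components `F_{1i}` -/

variable {A : SmoothOneForm I M}

theorem maxwell_eq_zero_of_frame (he : g.IsNullFrameOn e U) {x : M} (hx : x ∈ U)
    {v : TangentSpace I x} (h : ∀ a, g.maxwell A x v (e a x) = 0) : g.maxwell A x v = 0 := by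
  refine (he.toIsLocalFrameOn.toBasisAt hx).ext fun a ↦ ?_
  simpa using h a

theorem maxwell_zero_left (he : g.IsNullFrameOn e U) {x : M} (hx : x ∈ U)
    (hF01 : g.maxwell A x (e 0 x) (e 1 x) = 0)
    (hF0i : ∀ i : Fin d, g.maxwell A x (e 0 x) (e i.succ.succ x) = 0) :
    g.maxwell A x (e 0 x) = 0 := by
  refine he.maxwell_eq_zero_of_frame hx fun a ↦ ?_
  refine Fin.cases ?_ (fun a ↦ Fin.cases hF01 hF0i a) a
  exact g.maxwell_self A x (e 0 x)

/-- Only the n-component of v, which is g(v, ℓ), pairs nontrivially with e_j. -/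
theorem maxwell_frame_right (he : g.IsNullFrameOn e U) {x : M} (hx : x ∈ U)
    (h0 : g.maxwell A x (e 0 x) = 0)
    (hFij : ∀ i j : Fin d, g.maxwell A x (e i.succ.succ x) (e j.succ.succ x) = 0)
    (v : TangentSpace I x) (j : Fin d) :
    g.maxwell A x v (e j.succ.succ x)
      = g.val x v (e 0 x) * g.maxwell A x (e 1 x) (e j.succ.succ x) := by
  conv_lhs => rw [he.expansion hx v]
  simp [h0, hFij]

/-- The Bianchi identity for ℓ, e_i, e_j; the term F([e_i, e_j], ℓ) drops out. -/
theorem kappa_mul_maxwell_comm (he : g.IsNullFrameOn e U) (hU : IsOpen U)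
    (h0 : ∀ x ∈ U, g.maxwell A x (e 0 x) = 0)
    (hFij : ∀ x ∈ U, ∀ i j : Fin d, g.maxwell A x (e i.succ.succ x) (e j.succ.succ x) = 0)
    {x : M} (hx : x ∈ U) (i j : Fin d) :
    g.val x (g.kappa (e 0) x) (e i.succ.succ x) * g.maxwell A x (e 1 x) (e j.succ.succ x)
      = g.val x (g.kappa (e 0) x) (e j.succ.succ x)
        * g.maxwell A x (e 1 x) (e i.succ.succ x) := by
  have hne : e 0 x ≠ 0 := (he.linearIndependent hx).ne_zero 0
  have h := g.maxwell_mlieBracket_cyclic A hU (he.contMDiffOn 0) (he.contMDiffOn i.succ.succ)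
    (he.contMDiffOn j.succ.succ) (fun y hy ↦ by simp [h0 y hy]) (fun y hy ↦ hFij y hy i j)
    (fun y hy ↦ by rw [g.maxwell_swap]; simp [h0 y hy]) hx hne
  rw [g.maxwell_swap A x _ (e 0 x), h0 x hx,
    VectorField.mlieBracket_swap_apply (V := e j.succ.succ), map_neg, LinearMap.neg_apply,
    he.maxwell_frame_right hx (h0 x hx) (hFij x hx) (VectorField.mlieBracket I _ _ x) i,
    he.maxwell_frame_right hx (h0 x hx) (hFij x hx) (VectorField.mlieBracket I _ _ x) j,
    he.val_mlieBracket_zero hU hx, he.val_mlieBracket_zero hU hx, LinearMap.zero_apply] at h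
  linarith

theorem sum_kappa_mul_maxwell (he : g.IsNullFrameOn e U) (hU : IsOpen U)
    (h0 : ∀ x ∈ U, g.maxwell A x (e 0 x) = 0)
    (hFij : ∀ x ∈ U, ∀ i j : Fin d, g.maxwell A x (e i.succ.succ x) (e j.succ.succ x) = 0)
    {f : M → ℝ} {x : M} (hx : x ∈ U) (hf : f x ≠ 0)
    (hdiv : g.divergence (g.raisedMaxwell A f) (e 0) x = 0) :
    ∑ i : Fin d, g.val x (g.kappa (e 0) x) (e i.succ.succ x)
      * g.maxwell A x (e 1 x) (e i.succ.succ x) = 0 := by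
  -- The raised tensor S kills ℓ near x, so ∇(Sℓ) = 0 and the divergence is minus the trace of S ∘
  -- ∇ℓ; no derivative of f enters.
  have hz : (fun y ↦ g.raisedMaxwell A f y (e 0 y)) =ᶠ[nhds x] (0 : Π y : M, TangentSpace I y) := by
    filter_upwards [hU.mem_nhds hx] with y hy
    rw [raisedMaxwell, LinearMap.smul_apply, LinearMap.comp_apply, h0 y hy, map_zero, smul_zero]
    rfl
  have hz0 : MDiffAt (T% (0 : Π y : M, TangentSpace I y)) x :=
    mdifferentiableAt_zeroSection ..
  have hz1 : MDiffAt (T% (fun y ↦ g.raisedMaxwell A f y (e 0 y))) x :=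
    hz0.congr_of_eventuallyEq (hz.mono fun y hy ↦ by simp only [hy])
  have hL : g.leviCivita (fun y ↦ g.raisedMaxwell A f y (e 0 y)) x = 0 := by
    rw [g.leviCivita.isCovariantDerivativeOnUniv.congr_of_eventuallyEq hz1 hz0
      Filter.univ_mem hz, g.leviCivita.zero]
    rfl
  have hT : ∀ u w : TangentSpace I x, g.val x
      ((g.raisedMaxwell A f x ∘ₗ (g.leviCivita (e 0) x).toLinearMap) u) w
        = f x * g.maxwell A x (g.leviCivita (e 0) x u) w := by
    intro u w
    simp [raisedMaxwell, val_sharp]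
  rw [divergence, hL, ContinuousLinearMap.toLinearMap_zero, zero_sub, map_neg, neg_eq_zero,
    he.trace_eq hx] at hdiv
  simp only [hT] at hdiv
  -- In the trace, the n term contains F(∇_n ℓ, ℓ) = 0 and each e_i term a factor g(∇ℓ, ℓ) = 0. Only
  -- f F(∇_ℓ ℓ, n) survives.
  rw [g.maxwell_swap A x _ (e 0 x), h0 x hx, LinearMap.zero_apply, neg_zero, mul_zero, add_zero,
    Finset.sum_eq_zero fun i _ ↦ by rw [he.maxwell_frame_right hx (h0 x hx) (hFij x hx),
      he.val_nabla_zero hU hx, zero_mul, mul_zero], add_zero] at hdiv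
  replace hdiv : g.maxwell A x (g.kappa (e 0) x) (e 1 x) = 0 :=
    (mul_eq_zero.1 hdiv).resolve_left hf
  rw [g.maxwell_swap, he.expansion hx (g.kappa (e 0) x)] at hdiv
  have h10 : g.maxwell A x (e 1 x) (e 0 x) = 0 := by
    rw [g.maxwell_swap, h0 x hx]; simp
  rw [neg_eq_zero] at hdiv
  simpa only [map_add, map_sum, map_smul, h10, g.maxwell_self, smul_eq_mul, mul_zero,
    zero_add] using hdiv

end IsNullFrameOn
end LorentzMetric
end NullFrameMaxwell

/-! ### The dichotomy: vanishing field or weakly geodetic ℓ -/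

theorem mainTheorem10 {d : ℕ} (hd : 2 ≤ d)
    {M : Type*} [TopologicalSpace M] [ChartedSpace (EuclideanSpace ℝ (Fin (d + 2))) M]
    [IsManifold (𝓡 (d + 2)) ∞ M]
    (g : LorentzMetric (𝓡 (d + 2)) M) (A : SmoothOneForm (𝓡 (d + 2)) M)
    (φ : M → ℝ) (hφ : ContMDiff (𝓡 (d + 2)) 𝓘(ℝ, ℝ) ∞ φ) (α β : ℝ) (hα : α ≠ 0) (hβ : β ≠ 0)
    (U : Set M) (hU : IsOpen U)
    (e : Fin (d + 2) → Π x : M, TangentSpace (𝓡 (d + 2)) x) (he : g.IsNullFrameOn e U)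
    (hFij : ∀ x ∈ U, ∀ i j : Fin d, g.maxwell A x (e i.succ.succ x) (e j.succ.succ x) = 0)
    (hF01 : ∀ x ∈ U, g.maxwell A x (e 0 x) (e 1 x) = 0)
    (hF0i : ∀ x ∈ U, ∀ i : Fin d, g.maxwell A x (e 0 x) (e i.succ.succ x) = 0)
    (hMaxwell : g.ReducedMaxwellOn A φ α β U) :
    ∀ x ∈ U, (g.maxwell A x = 0 ∨ g.IsWeaklyGeodeticAt (e 0) x) ∧
      ∀ (a b : Fin (d + 2)) (i : Fin d),
        g.maxwell A x (e a x) (e b x) *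
          he.toIsLocalFrameOn.coeff i.succ.succ x (g.kappa (e 0) x) = 0 := by
  intro x hx
  have h0 : ∀ x ∈ U, g.maxwell A x (e 0 x) = 0 := fun y hy ↦
    he.maxwell_zero_left hy (hF01 y hy) (hF0i y hy)
  have hsum := he.sum_kappa_mul_maxwell hU h0 hFij hx (Real.exp_pos _).ne'
    (hMaxwell x hx (e 0) ((he.contMDiffOn 0).contMDiffAt (hU.mem_nhds hx)))
  have hcomm := he.kappa_mul_maxwell_comm hU h0 hFij hx
  have hdich : g.maxwell A x = 0 ∨
      ∀ i : Fin d, g.val x (g.kappa (e 0) x) (e i.succ.succ x) = 0 := by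
    by_cases hω : ∀ i : Fin d, g.maxwell A x (e 1 x) (e i.succ.succ x) = 0
    · left
      have h1 : g.maxwell A x (e 1 x) = 0 := by
        refine he.maxwell_eq_zero_of_frame hx fun a ↦ ?_
        refine Fin.cases ?_ (fun a ↦ Fin.cases ?_ hω a) a
        · rw [g.maxwell_swap, h0 x hx]; simp
        · exact g.maxwell_self A x (e 1 x)
      refine (he.toIsLocalFrameOn.toBasisAt hx).ext fun a ↦ ?_
      rw [IsLocalFrameOn.toBasisAt_coe, LinearMap.zero_apply]
      refine Fin.cases (h0 x hx) (fun a ↦ Fin.cases h1 (fun i ↦ ?_) a) a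
      refine he.maxwell_eq_zero_of_frame hx fun b ↦ ?_
      rw [g.maxwell_swap]
      refine Fin.cases ?_ (fun b ↦ Fin.cases ?_ (fun j ↦ ?_) b) b
      · simp [h0 x hx]
      · exact neg_eq_zero.2 (hω i)
      · exact neg_eq_zero.2 (hFij x hx j i)
    · right
      push Not at hω
      obtain ⟨j, hj⟩ := hω
      have hj' : g.val x (g.kappa (e 0) x) (e j.succ.succ x) = 0 := by
        -- κ_j ω_i² = ω_j κ_i ω_i by the commutation relation; summing over i gives κ_j |ω|² = 0,
        -- with |ω|² > 0 since ω_j ≠ 0.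
        have hs : ∑ i : Fin d, g.val x (g.kappa (e 0) x) (e j.succ.succ x)
            * g.maxwell A x (e 1 x) (e i.succ.succ x) ^ 2 = 0 := by
          rw [← mul_zero (g.maxwell A x (e 1 x) (e j.succ.succ x)), ← hsum, Finset.mul_sum]
          refine Finset.sum_congr rfl fun i _ ↦ ?_
          linear_combination (g.maxwell A x (e 1 x) (e i.succ.succ x)) * hcomm j i
        rw [← Finset.mul_sum] at hs
        refine (mul_eq_zero.1 hs).resolve_right (ne_of_gt ?_)
        exact Finset.sum_pos' (fun i _ ↦ sq_nonneg _) ⟨j, Finset.mem_univ _, by positivity⟩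
      intro i
      have h := hcomm i j
      rw [hj', zero_mul] at h
      exact (mul_eq_zero.1 h).resolve_right hj
  -- The proportionality factor is g(κ, n), the coefficient of κ along ℓ in the frame expansion.
  refine ⟨hdich.imp_right fun hκ ↦ ⟨g.val x (g.kappa (e 0) x) (e 1 x), ?_⟩, fun a b i ↦ ?_⟩
  · have h := he.expansion hx (g.kappa (e 0) x)
    have hκ0 : g.val x (g.kappa (e 0) x) (e 0 x) = 0 := he.val_nabla_zero hU hx _
    simpa only [hκ, hκ0, zero_smul, Finset.sum_const_zero, add_zero] using h
  · rw [he.coeff_succ_succ hx]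
    rcases hdich with h | h
    · simp [h]
    · simp [h i]
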